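/- For positive integers $s_1,\dots,s_r$ with $s_1\ge 2$ let $$\zeta^\star(s_1,\dots,s_r)=\sum_{k_1\ge\cdots\ge k_r\ge 1}\frac{1}{k_1^{s_1}\cdots k_r^{s_r}}$$ be the (convergent) multiple zeta star value. Write $\{2\}^a$ for $a$ successive repetitions of $2$, and let $B_m$ denote the Bernoulli numbers. For integers $d\ge 1$ and $n\ge 0$ put $$Z^\star(d,n)=\sum_{\substack{a_1+\cdots+a_{2d+1}=n\\ a_1,\dots,a_{2d+1}\ge 0}}\zeta^\star(\{2\}^{a_1},3,\{2\}^{a_2},1,\dots,3,\{2\}^{a_{2d}},1,\{2\}^{a_{2d+1}}),$$ $$Z^\star_0(d,n)=\sum_{\substack{a_1+\cdots+a_{2d}=n\\ a_1,\dots,a_{2d}\ge 0}}\zeta^\star(\{2\}^{a_1},3,\{2\}^{a_2},1,\dots,3,\{2\}^{a_{2d}},1),$$ and, for $n\ge 1$, $$Z^\star_1(d,n)=\sum_{\substack{a_1+\cdots+a_{2d+1}=n-1\\ a_1,\dots,a_{2d+1}\ge 0}}\zeta^\star(\{2\}^{a_1},3,\{2\}^{a_2},1,\dots,3,\{2\}^{a_{2d}},1,\{2\}^{a_{2d+1}+1}).$$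 Then, for any integers $d\ge 1$ and $n\ge 0$, all the series $\zeta^\star$ occurring in these sums converge, and $$Z^\star_0(d,n)=4\pi^{2n+4d}\sum_{k=0}^{n+2d}\sum_{r=0}^n(-1)^{n+k+r}(4^{k+1}-1)\binom{k}{r}\binom{n+2d-k}{n-r}\frac{B_{2k+2}}{(2k+2)!}\frac{B_{2n+4d-2k}}{(2n+4d-2k)!},$$ $$Z^\star(d,n)=4\pi^{2n+4d}\sum_{k=0}^{n+2d}\sum_{r=0}^n(-1)^{n+k+r}(4^{k+1}-1)\binom{k+1}{r}\binom{n+2d-k}{n-r}\frac{B_{2k+2}}{(2k+2)!}\frac{B_{2n+4d-2k}}{(2n+4d-2k)!},$$ and, for $n\ge 1$, $$Z^\star_1(d,n)=4\pi^{2n+4d}\sum_{k=0}^{n+2d}\sum_{r=0}^{n-1}(-1)^{n+k+r+1}(4^{k+1}-1)\binom{k}{r}\binom{n+2d-k}{n-1-r}\frac{B_{2k+2}}{(2k+2)!}\frac{B_{2n+4d-2k}}{(2n+4d-2k)!}.$$ -/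

import Mathlib

/-- The general term `1 / (k₁ ^ s₁ ⋯ k_r ^ s_r)` of the series `ζ⋆(s₁, …, s_r)`, indexed by the
tuples of integers `k₁ ≥ ⋯ ≥ k_r ≥ 1`. -/
noncomputable def zetaStarTerm (s : List ℕ)
    (k : {k : Fin s.length → ℕ // Antitone k ∧ ∀ i, 1 ≤ k i}) : ℝ :=
  1 / ∏ i, (k.1 i : ℝ) ^ s.get i

/-- The multiple zeta star value `ζ⋆(s₁, …, s_r)`. -/
noncomputable def zetaStar (s : List ℕ) : ℝ :=
  ∑' k, zetaStarTerm s k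

/-- The word `{2}^{a₁}, 3, {2}^{a₂}, 1, …, 3, {2}^{a_{2d}}, 1`
(with `a₁, …, a_{2d}` numbered from `0` to `2 * d - 1`). -/
def word321 (d : ℕ) (a : Fin (2 * d) → ℕ) : List ℕ :=
  (List.ofFn fun j : Fin d =>
    List.replicate (a ⟨2 * j, by omega⟩) 2 ++ [3] ++
      List.replicate (a ⟨2 * j + 1, by omega⟩) 2 ++ [1]).flatten

/-- `Z⋆(d, n)`, the sum of `ζ⋆({2}^{a₁}, 3, {2}^{a₂}, 1, …, 3, {2}^{a_{2d}}, 1, {2}^{a_{2d+1}})`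
over all `a₁ + ⋯ + a_{2d+1} = n`. -/
noncomputable def ZStar (d n : ℕ) : ℝ :=
  ∑ a ∈ Finset.Nat.antidiagonalTuple (2 * d + 1) n,
    zetaStar (word321 d (fun i => a i.castSucc) ++ List.replicate (a (Fin.last (2 * d))) 2)

/-- `Z⋆₀(d, n)`, the sum of `ζ⋆({2}^{a₁}, 3, {2}^{a₂}, 1, …, 3, {2}^{a_{2d}}, 1)`
over all `a₁ + ⋯ + a_{2d} = n`. -/
noncomputable def ZStar₀ (d n : ℕ) : ℝ :=
  ∑ a ∈ Finset.Nat.antidiagonalTuple (2 * d) n, zetaStar (word321 d a)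

/-- `Z⋆₁(d, n)`, the sum of
`ζ⋆({2}^{a₁}, 3, {2}^{a₂}, 1, …, 3, {2}^{a_{2d}}, 1, {2}^{a_{2d+1} + 1})`
over all `a₁ + ⋯ + a_{2d+1} = n - 1` (an empty sum for `n = 0`). -/
noncomputable def ZStar₁ (d : ℕ) : ℕ → ℝ
  | 0 => 0
  | m + 1 =>
    ∑ a ∈ Finset.Nat.antidiagonalTuple (2 * d + 1) m,
      zetaStar (word321 d (fun i => a i.castSucc) ++
        List.replicate (a (Fin.last (2 * d)) + 1) 2)

/-!
Truncate all sums at `k₁ ≤ N` and add up the truncated values over the words in question, weighting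
the words that end in `2` by `c`: `c = 0` gives `Z⋆₀` and `c = 1` gives `Z⋆`. Let `x` mark the
letters `2` and `y` the odd letters. Splitting off the first letter gives a recursion in `N` that
couples the generating functions of the words with an even and with an odd number of odd letters.
It is diagonalised by the sequences `N ↦ N!² / ((N - k)! (N + k)!)`, each of which tends to `1`, and
the coefficients of the solution are quotients of partial products of Euler's product for
`tanc u = tan (π √u / 2) / (π √u / 2)`. For `N → ∞` the even generating function thus tends to
`((1 + c x / y) Q + (1 - c x / y) Q⁻¹) / 2` with `Q = tanc (x + y) / tanc (x - y)`.

As all terms are nonnegative, the finite limit bounds the truncated sums, so that the series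
converge, and it is also the generating function of the limits. The power series of `tanc` and
`1 / tanc` have Bernoulli numbers as coefficients, and the theorem compares the coefficients of the
monomials `xⁿ y²ᵈ`, where the two halves contribute equally.
-/

open Filter Topology
open Finset.HasAntidiagonal (antidiagonal mem_antidiagonal)
open Finset.Nat (antidiagonalTuple mem_antidiagonalTuple)

/-! ### Truncated multiple zeta star values -/

/-- The truncation `∑_{N ≥ k₁ ≥ ⋯ ≥ k_r ≥ 1} 1 / (k₁ ^ s₁ ⋯ k_r ^ s_r)` of `ζ⋆(s₁, …, s_r)`,
by recursion on the first letter. -/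
noncomputable def truncZetaStar : List ℕ → ℕ → ℝ
  | [], _ => 1
  | s :: l, N => ∑ k ∈ Finset.Icc 1 N, 1 / (k : ℝ) ^ s * truncZetaStar l k

theorem truncZetaStar_cons_zero (s : ℕ) (l : List ℕ) : truncZetaStar (s :: l) 0 = 0 := by
  simp [truncZetaStar]

theorem truncZetaStar_cons_succ (s : ℕ) (l : List ℕ) (N : ℕ) :
    truncZetaStar (s :: l) (N + 1) =
      truncZetaStar (s :: l) N + 1 / ((N : ℝ) + 1) ^ s * truncZetaStar l (N + 1) := by
  simp [truncZetaStar, Finset.sum_Icc_succ_top]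

theorem truncZetaStar_nonneg (s : List ℕ) (N : ℕ) : 0 ≤ truncZetaStar s N := by
  induction s generalizing N with
  | nil => exact zero_le_one
  | cons s l ih => exact Finset.sum_nonneg fun k _ => mul_nonneg (by positivity) (ih k)

theorem monotone_truncZetaStar (s : List ℕ) : Monotone (truncZetaStar s) := by
  refine monotone_nat_of_le_succ fun N => ?_
  cases s with
  | nil => exact le_rfl
  | cons s l =>
    rw [truncZetaStar_cons_succ]
    exact le_add_of_nonneg_right (mul_nonneg (by positivity) (truncZetaStar_nonneg l _))

theorem antitone_finCons_iff {α : Type*} [Preorder α] {r : ℕ} {m : α} {k : Fin r → α} :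
    Antitone (Fin.cons m k : Fin (r + 1) → α) ↔ (∀ i, k i ≤ m) ∧ Antitone k := by
  simp [Antitone, Fin.forall_fin_succ]

/-- The finite set of antitone `r`-tuples with entries in `[1, N]`, over which the truncated
multiple zeta star values are summed. -/
def antitoneTuples (r N : ℕ) : Finset (Fin r → ℕ) :=
  open Classical in {k ∈ Fintype.piFinset fun _ => Finset.Icc 1 N | Antitone k}

theorem mem_antitoneTuples {r N : ℕ} {k : Fin r → ℕ} :
    k ∈ antitoneTuples r N ↔ (∀ i, 1 ≤ k i ∧ k i ≤ N) ∧ Antitone k := by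
  simp [antitoneTuples]

theorem finCons_mem_antitoneTuples {r N m : ℕ} {k : Fin r → ℕ} :
    (Fin.cons m k : Fin (r + 1) → ℕ) ∈ antitoneTuples (r + 1) N ↔
      m ∈ Finset.Icc 1 N ∧ k ∈ antitoneTuples r m := by
  simp only [mem_antitoneTuples, antitone_finCons_iff, Fin.forall_fin_succ, Fin.cons_zero,
    Fin.cons_succ, Finset.mem_Icc]
  exact ⟨fun h => ⟨h.1.1, fun i => ⟨(h.1.2 i).1, h.2.1 i⟩, h.2.2⟩,
    fun h => ⟨⟨h.1, fun i => ⟨(h.2.1 i).1, (h.2.1 i).2.trans h.1.2⟩⟩,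
      fun i => (h.2.1 i).2, h.2.2⟩⟩

theorem sum_antitoneTuples_succ {M : Type*} [AddCommMonoid M] (r N : ℕ)
    (f : (Fin (r + 1) → ℕ) → M) :
    ∑ k ∈ antitoneTuples (r + 1) N, f k =
      ∑ m ∈ Finset.Icc 1 N, ∑ k ∈ antitoneTuples r m, f (Fin.cons m k) := by
  rw [Finset.sum_sigma']
  refine Finset.sum_bij' (fun k _ => ⟨k 0, Fin.tail k⟩) (fun p _ => Fin.cons p.1 p.2)
    (fun k hk => ?_) (fun p hp => ?_) (fun k _ => Fin.cons_self_tail k) (fun p _ => by simp)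
    (fun k _ => by rw [Fin.cons_self_tail])
  · rwa [Finset.mem_sigma, ← finCons_mem_antitoneTuples, Fin.cons_self_tail]
  · rwa [finCons_mem_antitoneTuples, ← Finset.mem_sigma]

theorem sum_antitoneTuples_eq_truncZetaStar (s : List ℕ) (N : ℕ) :
    ∑ k ∈ antitoneTuples s.length N, 1 / ∏ i, (k i : ℝ) ^ s.get i = truncZetaStar s N := by
  induction s generalizing N with
  | nil =>
    have h : antitoneTuples ([] : List ℕ).length N = {Fin.elim0} :=
      Finset.eq_singleton_iff_unique_mem.2 ⟨mem_antitoneTuples.2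
        ⟨fun i => i.elim0, fun i => i.elim0⟩, fun k _ => funext fun i => i.elim0⟩
    rw [h]
    simp [truncZetaStar]
  | cons s l ih =>
    refine (sum_antitoneTuples_succ l.length N
      fun k => 1 / ∏ i : Fin (l.length + 1), (k i : ℝ) ^ (s :: l).get i).trans ?_
    refine Finset.sum_congr rfl fun m _ => ?_
    rw [← ih, Finset.mul_sum]
    refine Finset.sum_congr rfl fun k _ => ?_
    rw [Fin.prod_univ_succ, one_div_mul_one_div]
    rfl

/-- The indices of the series `zetaStarTerm s` all of whose entries are at most `N`; these finite
sets exhaust the index type. -/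
def zetaStarIndex (s : List ℕ) (N : ℕ) :
    Finset {k : Fin s.length → ℕ // Antitone k ∧ ∀ i, 1 ≤ k i} :=
  open Classical in (antitoneTuples s.length N).subtype _

theorem mem_zetaStarIndex {s : List ℕ} {N : ℕ}
    {k : {k : Fin s.length → ℕ // Antitone k ∧ ∀ i, 1 ≤ k i}} :
    k ∈ zetaStarIndex s N ↔ ∀ i, k.1 i ≤ N := by
  simp only [zetaStarIndex, Finset.mem_subtype, mem_antitoneTuples]
  exact ⟨fun h i => (h.1 i).2, fun h => ⟨fun i => ⟨k.2.2 i, h i⟩, k.2.1⟩⟩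

theorem sum_zetaStarIndex (s : List ℕ) (N : ℕ) :
    ∑ k ∈ zetaStarIndex s N, zetaStarTerm s k = truncZetaStar s N := by
  classical
  rw [← sum_antitoneTuples_eq_truncZetaStar, zetaStarIndex]
  exact Finset.sum_subtype_of_mem (fun k : Fin s.length → ℕ => 1 / ∏ i, (k i : ℝ) ^ s.get i)
    fun k hk => ⟨(mem_antitoneTuples.1 hk).2, fun i => ((mem_antitoneTuples.1 hk).1 i).1⟩

theorem tendsto_zetaStarIndex (s : List ℕ) : Tendsto (zetaStarIndex s) atTop atTop := by
  refine tendsto_atTop_finset_of_monotone (fun M N hMN k hk => ?_) fun k => ?_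
  · exact mem_zetaStarIndex.2 fun i => (mem_zetaStarIndex.1 hk i).trans hMN
  · exact ⟨∑ i, k.1 i, mem_zetaStarIndex.2 fun i =>
      Finset.single_le_sum (fun _ _ => Nat.zero_le _) (Finset.mem_univ i)⟩

theorem zetaStarTerm_nonneg (s : List ℕ) (k) : 0 ≤ zetaStarTerm s k :=
  one_div_nonneg.2 (Finset.prod_nonneg fun _ _ => by positivity)

theorem summable_zetaStarTerm_of_truncZetaStar_le {s : List ℕ} {c : ℝ}
    (h : ∀ N, truncZetaStar s N ≤ c) : Summable (zetaStarTerm s) := by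
  refine summable_of_sum_le (c := c) (zetaStarTerm_nonneg s) fun u => ?_
  obtain ⟨N, hN⟩ := ((tendsto_zetaStarIndex s).eventually_ge_atTop u).exists
  calc ∑ k ∈ u, zetaStarTerm s k ≤ ∑ k ∈ zetaStarIndex s N, zetaStarTerm s k :=
        Finset.sum_le_sum_of_subset_of_nonneg hN fun k _ _ => zetaStarTerm_nonneg s k
    _ = truncZetaStar s N := sum_zetaStarIndex s N
    _ ≤ c := h N

theorem tendsto_truncZetaStar {s : List ℕ} (h : Summable (zetaStarTerm s)) :
    Tendsto (truncZetaStar s) atTop (𝓝 (zetaStar s)) :=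
  (h.hasSum.comp (tendsto_zetaStarIndex s)).congr (sum_zetaStarIndex s)

/-! ### Words in the letters 1, 2, 3 -/

theorem sum_antidiagonalTuple_insertNth {M : Type*} [AddCommMonoid M] {r : ℕ} (i : Fin (r + 1))
    (n : ℕ) (f : (Fin (r + 1) → ℕ) → M) :
    ∑ a ∈ antidiagonalTuple (r + 1) n, f a =
      ∑ p ∈ antidiagonal n, ∑ a ∈ antidiagonalTuple r p.2, f (i.insertNth p.1 a) := by
  rw [Finset.sum_sigma']
  refine Finset.sum_bij' (fun a _ => ⟨(a i, ∑ j, i.removeNth a j), i.removeNth a⟩)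
    (fun p _ => i.insertNth p.1.1 p.2) (fun a ha => ?_) (fun p hp => ?_)
    (fun a _ => Fin.insertNth_self_removeNth i a) (fun p hp => ?_)
    (fun a _ => by rw [Fin.insertNth_self_removeNth])
  · rw [mem_antidiagonalTuple, Fin.sum_univ_succAbove _ i] at ha
    exact Finset.mem_sigma.2 ⟨mem_antidiagonal.2 ha, mem_antidiagonalTuple.2 rfl⟩
  · obtain ⟨hn, ha⟩ := Finset.mem_sigma.1 hp
    rw [mem_antidiagonalTuple] at ha ⊢
    simpa [Fin.sum_univ_succAbove _ i, ha] using hn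
  · obtain ⟨⟨j, k⟩, a⟩ := p
    obtain rfl : ∑ j, a j = k := mem_antidiagonalTuple.1 (Finset.mem_sigma.1 hp).2
    simp

theorem sum_antidiagonalTuple_cons {M : Type*} [AddCommMonoid M] (r n : ℕ)
    (f : (Fin (r + 1) → ℕ) → M) :
    ∑ a ∈ antidiagonalTuple (r + 1) n, f a =
      ∑ p ∈ antidiagonal n, ∑ a ∈ antidiagonalTuple r p.2, f (Fin.cons p.1 a) := by
  simpa only [Fin.insertNth_zero'] using sum_antidiagonalTuple_insertNth 0 n f

theorem sum_antidiagonalTuple_snoc {M : Type*} [AddCommMonoid M] (r n : ℕ)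
    (f : (Fin (r + 1) → ℕ) → M) :
    ∑ a ∈ antidiagonalTuple (r + 1) n, f a =
      ∑ p ∈ antidiagonal n, ∑ a ∈ antidiagonalTuple r p.2, f (Fin.snoc a p.1) := by
  simpa only [Fin.insertNth_last'] using sum_antidiagonalTuple_insertNth (Fin.last r) n f

theorem sum_antidiagonal_left_comm {M : Type*} [AddCommMonoid M] (n : ℕ) (f : ℕ → ℕ → ℕ → M) :
    ∑ p ∈ antidiagonal n, ∑ q ∈ antidiagonal p.2, f p.1 q.1 q.2 =
      ∑ p ∈ antidiagonal n, ∑ q ∈ antidiagonal p.2, f q.1 p.1 q.2 := by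
  simp only [Finset.sum_sigma']
  refine Finset.sum_nbij' (fun x => ⟨(x.2.1, x.1.1 + x.2.2), (x.1.1, x.2.2)⟩)
    (fun x => ⟨(x.2.1, x.1.1 + x.2.2), (x.1.1, x.2.2)⟩) ?_ ?_ ?_ ?_ ?_ <;>
  grind [mem_antidiagonal]

/-- The odd letter that heads an alternating word in `3` and `1` with `m` odd letters, the last of
which is `1`. -/
def oddLetter (m : ℕ) : ℕ := if Even m then 3 else 1

/-- The sum of `φ` over the words with `m` odd letters (alternately `3` and `1`, the last one being
`1`) and `n` letters `2`, where the words that end in `2` are weighted by `c`. Thus `c = 1` gives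
all words and `c = 0` those that end in `1`. -/
noncomputable def wordSum (c : ℝ) : ℕ → ℕ → (List ℕ → ℝ) → ℝ
  | 0, n, φ => (if n = 0 then 1 else c) * φ (List.replicate n 2)
  | m + 1, n, φ => ∑ p ∈ antidiagonal n,
      wordSum c m p.2 fun l => φ (List.replicate p.1 2 ++ oddLetter (m + 1) :: l)

section wordSum

variable (c : ℝ)

theorem wordSum_succ_zero (m : ℕ) (φ : List ℕ → ℝ) :
    wordSum c (m + 1) 0 φ = wordSum c m 0 fun l => φ (oddLetter (m + 1) :: l) := by
  simp [wordSum]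

theorem wordSum_succ_succ (m n : ℕ) (φ : List ℕ → ℝ) :
    wordSum c (m + 1) (n + 1) φ = wordSum c m (n + 1) (fun l => φ (oddLetter (m + 1) :: l)) +
      wordSum c (m + 1) n fun l => φ (2 :: l) := by
  simp only [wordSum, Finset.Nat.sum_antidiagonal_succ]
  rfl

theorem wordSum_add (m n : ℕ) (φ ψ : List ℕ → ℝ) :
    wordSum c m n (fun l => φ l + ψ l) = wordSum c m n φ + wordSum c m n ψ := by
  induction m generalizing n φ ψ with
  | zero => exact mul_add _ _ _
  | succ m ih => simp only [wordSum, ih, Finset.sum_add_distrib]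

theorem wordSum_const_mul (m n : ℕ) (b : ℝ) (φ : List ℕ → ℝ) :
    wordSum c m n (fun l => b * φ l) = b * wordSum c m n φ := by
  induction m generalizing n φ with
  | zero => exact mul_left_comm _ _ _
  | succ m ih => simp only [wordSum, ih, Finset.mul_sum]

theorem wordSum_zero (m n : ℕ) : wordSum c m n (fun _ => 0) = 0 := by
  simpa using wordSum_const_mul c m n 0 fun _ => 0

variable {c} in
theorem wordSum_mono (hc : 0 ≤ c) (m n : ℕ) {φ ψ : List ℕ → ℝ} (h : ∀ l, φ l ≤ ψ l) :
    wordSum c m n φ ≤ wordSum c m n ψ := by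
  induction m generalizing n φ ψ with
  | zero => exact mul_le_mul_of_nonneg_left (h _) (by positivity)
  | succ m ih => exact Finset.sum_le_sum fun p _ => ih _ fun l => h _

theorem wordSum_eq_sum_append (m n : ℕ) (φ : List ℕ → ℝ) :
    wordSum c m n φ = ∑ p ∈ antidiagonal n,
      (if p.1 = 0 then 1 else c) * wordSum 0 m p.2 fun l => φ (l ++ List.replicate p.1 2) := by
  induction m generalizing n φ with
  | zero =>
    rw [Finset.sum_eq_single_of_mem (n, 0) (by simp) fun p hp hne => ?_]
    · simp [wordSum]
    · have h2 : p.2 ≠ 0 := fun h => hne (Prod.ext (by simpa [h] using mem_antidiagonal.1 hp) h)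
      simp [wordSum, h2]
  | succ m ih =>
    simp only [wordSum, ih, Finset.mul_sum, List.append_assoc, List.cons_append]
    exact sum_antidiagonal_left_comm n fun i j k => (if j = 0 then 1 else c) *
      wordSum 0 m k fun l => φ (List.replicate i 2 ++ oddLetter (m + 1) ::
        (l ++ List.replicate j 2))

end wordSum

theorem word321_succ (d i j : ℕ) (a : Fin (2 * d) → ℕ) :
    word321 (d + 1) (Fin.cons i (Fin.cons j a : Fin (2 * d + 1) → ℕ) : Fin (2 * d + 1 + 1) → ℕ) =
      List.replicate i 2 ++ 3 :: (List.replicate j 2 ++ 1 :: word321 d a) := by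
  simp only [word321, List.ofFn_succ, List.flatten_cons, List.append_assoc, List.cons_append,
    List.nil_append]
  rfl

theorem sum_word321 (d n : ℕ) (φ : List ℕ → ℝ) :
    ∑ a ∈ antidiagonalTuple (2 * d) n, φ (word321 d a) = wordSum 0 (2 * d) n φ := by
  induction d generalizing n φ with
  | zero => cases n <;> simp [wordSum, word321]
  | succ d ih =>
    have h1 : oddLetter (2 * d + 1) = 1 := if_neg (by simp [parity_simps])
    have h3 : oddLetter (2 * d + 1 + 1) = 3 := if_pos (by simp [parity_simps])
    change ∑ a ∈ antidiagonalTuple (2 * d + 1 + 1) n, _ = wordSum 0 (2 * d + 1 + 1) n φ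
    simp only [sum_antidiagonalTuple_cons, word321_succ, wordSum, h1, h3, ← ih]

theorem sum_word321_append (d n : ℕ) (φ : List ℕ → ℝ) :
    ∑ a ∈ antidiagonalTuple (2 * d + 1) n,
      φ (word321 d (fun i => a i.castSucc) ++ List.replicate (a (Fin.last (2 * d))) 2) =
        wordSum 1 (2 * d) n φ := by
  simp only [sum_antidiagonalTuple_snoc, Fin.snoc_castSucc, Fin.snoc_last,
    wordSum_eq_sum_append 1, ite_self, one_mul, ← sum_word321]

theorem le_wordSum_of_nonneg {φ : List ℕ → ℝ} (hφ : ∀ l, 0 ≤ φ l) (d : ℕ) (a : Fin (2 * d) → ℕ)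
    (b : ℕ) : φ (word321 d a ++ List.replicate b 2) ≤ wordSum 1 (2 * d) (∑ i, a i + b) φ := by
  rw [← sum_word321_append]
  have hmem : (Fin.snoc a b : Fin (2 * d + 1) → ℕ) ∈
      antidiagonalTuple (2 * d + 1) (∑ i, a i + b) := by
    simp [mem_antidiagonalTuple, Fin.sum_univ_castSucc]
  simpa using Finset.single_le_sum (fun a _ => hφ (word321 d (fun i => a i.castSucc) ++
    List.replicate (a (Fin.last (2 * d))) 2)) hmem

theorem ZStar_eq_add (d n : ℕ) : ZStar d n = ZStar₀ d n + ZStar₁ d n := by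
  cases n with
  | zero => simp [ZStar, ZStar₀, ZStar₁, sum_antidiagonalTuple_snoc]
  | succ n =>
    simp [ZStar, ZStar₀, ZStar₁, sum_antidiagonalTuple_snoc, Finset.Nat.sum_antidiagonal_succ]

/-! ### The transfer recursion -/

/-- The sum of the truncated values `truncZetaStar · N` over the words with `m` odd letters and `n`
letters `2`, the words that end in `2` being weighted by `c`. -/
noncomputable def truncSum (c : ℝ) (N m n : ℕ) : ℝ :=
  wordSum c m n fun l => truncZetaStar l N

section truncSum

variable (c : ℝ)

theorem truncSum_zero_zero (N : ℕ) : truncSum c N 0 0 = 1 := by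
  simp [truncSum, wordSum, truncZetaStar]

theorem truncSum_zero_of_add_pos {m n : ℕ} (h : 0 < m + n) : truncSum c 0 m n = 0 := by
  cases m with
  | zero =>
    obtain ⟨n, rfl⟩ := Nat.exists_eq_succ_of_ne_zero (by omega : n ≠ 0)
    simp [truncSum, wordSum, List.replicate_succ, truncZetaStar_cons_zero]
  | succ m =>
    have hφ (i : ℕ) (l : List ℕ) :
        truncZetaStar (List.replicate i 2 ++ oddLetter (m + 1) :: l) 0 = 0 := by
      cases i <;> simp [List.replicate_succ, truncZetaStar_cons_zero]
    simp [truncSum, wordSum, hφ, wordSum_zero]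

theorem truncSum_succ_zero_succ (N n : ℕ) : truncSum c (N + 1) 0 (n + 1) =
    truncSum c N 0 (n + 1) +
      1 / ((N : ℝ) + 1) ^ 2 * (truncSum c (N + 1) 0 n - if n = 0 then 1 - c else 0) := by
  rcases eq_or_ne n 0 with rfl | hn
  · simp [truncSum, wordSum, truncZetaStar_cons_succ, truncZetaStar, mul_add, mul_comm]
  · simp only [truncSum, wordSum, List.replicate_succ, truncZetaStar_cons_succ,
      Nat.add_eq_zero_iff, hn, one_ne_zero, and_false, if_false, sub_zero]
    ring

theorem truncSum_succ_succ_zero (N m : ℕ) : truncSum c (N + 1) (m + 1) 0 =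
    truncSum c N (m + 1) 0 +
      1 / ((N : ℝ) + 1) ^ oddLetter (m + 1) * truncSum c (N + 1) m 0 := by
  simp only [truncSum, wordSum_succ_zero, truncZetaStar_cons_succ, wordSum_add, wordSum_const_mul]

theorem truncSum_succ_succ_succ (N m n : ℕ) : truncSum c (N + 1) (m + 1) (n + 1) =
    truncSum c N (m + 1) (n + 1) +
      1 / ((N : ℝ) + 1) ^ oddLetter (m + 1) * truncSum c (N + 1) m (n + 1) +
      1 / ((N : ℝ) + 1) ^ 2 * truncSum c (N + 1) (m + 1) n := by
  simp only [truncSum, wordSum_succ_succ, truncZetaStar_cons_succ, wordSum_add, wordSum_const_mul]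
  ring

variable {c}

theorem truncSum_nonneg (hc : 0 ≤ c) (N m n : ℕ) : 0 ≤ truncSum c N m n := by
  rw [← wordSum_zero c m n]
  exact wordSum_mono hc m n fun l => truncZetaStar_nonneg l N

theorem monotone_truncSum (hc : 0 ≤ c) (m n : ℕ) : Monotone fun N => truncSum c N m n :=
  fun _ _ hMN => wordSum_mono hc m n fun l => monotone_truncZetaStar l hMN

end truncSum

theorem sum_antidiagonal_succ_eq_add {M : Type*} [AddCommMonoid M] {f a b : ℕ → ℕ → M}
    (h₀ : ∀ m, f 0 (m + 1) = b 0 m) (h₁ : ∀ n, f (n + 1) 0 = a n 0)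
    (h₂ : ∀ n m, f (n + 1) (m + 1) = b (n + 1) m + a n (m + 1)) (w : ℕ) :
    ∑ p ∈ antidiagonal (w + 1), f p.1 p.2 =
      ∑ p ∈ antidiagonal w, b p.1 p.2 + ∑ p ∈ antidiagonal w, a p.1 p.2 := by
  rw [Finset.Nat.sum_antidiagonal_succ, h₀]
  cases w with
  | zero => simp [h₁]
  | succ w =>
    rw [Finset.Nat.sum_antidiagonal_succ',
      Finset.Nat.sum_antidiagonal_succ (f := fun p => b p.1 p.2),
      Finset.Nat.sum_antidiagonal_succ' (f := fun p => a p.1 p.2)]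
    simp only [h₁, h₂, Finset.sum_add_distrib]
    abel

/-- The homogeneous part of degree `w` of the generating function `∑ xⁿ yᵐ truncSum c N m n`, in
which the terms with odd `m` carry an additional weight `s`. -/
noncomputable def wordGen (c x y s : ℝ) (N w : ℕ) : ℝ :=
  ∑ p ∈ antidiagonal w,
    x ^ p.1 * (y ^ p.2 * if Even p.2 then 1 else s) * truncSum c N p.2 p.1

theorem wordGen_neg (c x y s : ℝ) : wordGen c x (-y) s = wordGen c x y (-s) := by
  funext N w
  refine Finset.sum_congr rfl fun p _ => ?_
  rcases Nat.even_or_odd p.2 with h | h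
  · simp [h, h.neg_pow]
  · simp [Nat.not_even_iff_odd.2 h, h.neg_pow]

theorem wordGen_zero (c x y s : ℝ) (w : ℕ) :
    wordGen c x y s 0 w = if w = 0 then 1 else 0 := by
  split_ifs with h
  · simp [h, wordGen, truncSum_zero_zero]
  · refine Finset.sum_eq_zero fun p hp => ?_
    rw [mem_antidiagonal] at hp
    rw [truncSum_zero_of_add_pos c (by omega), mul_zero]

theorem one_div_pow_oddLetter_mul {M : ℝ} (hM : M ≠ 0) (m : ℕ) :
    1 / M ^ oddLetter (m + 1) * (if Even (m + 1) then 1 else 1 / M) =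
      (if Even m then 1 else 1 / M) / M ^ 2 := by
  rcases Nat.even_or_odd m with h | h
  · simp [oddLetter, h, Nat.even_add_one, pow_two]
  · simp only [oddLetter, Nat.even_add_one, Nat.not_even_iff_odd.2 h, not_false_eq_true, if_true,
      if_false]
    field_simp

/-- With the weight `s = 1 / (N + 1)`, each of the letters `3` and `1` contributes `(N + 1)⁻²`, just
like the letter `2`. -/
theorem wordGen_succ_succ (c x y : ℝ) (N w : ℕ) :
    wordGen c x y (1 / (N + 1)) (N + 1) (w + 1) = wordGen c x y (1 / (N + 1)) N (w + 1) +
      (x + y) / (N + 1) ^ 2 * wordGen c x y (1 / (N + 1)) (N + 1) w -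
      if w = 0 then (1 - c) * x / (N + 1) ^ 2 else 0 := by
  have hM : (N : ℝ) + 1 ≠ 0 := by positivity
  set ε : ℕ → ℝ := fun m => if Even m then 1 else 1 / ((N : ℝ) + 1) with hε
  have hodd (m : ℕ) : 1 / ((N : ℝ) + 1) ^ oddLetter (m + 1) * ε (m + 1) =
      ε m / (N + 1) ^ 2 := one_div_pow_oddLetter_mul hM m
  set h : ℕ → ℕ → ℝ := fun n m => x ^ n * (y ^ m * ε m) * truncSum c (N + 1) m n with hh
  have key := sum_antidiagonal_succ_eq_add
    (f := fun n m => x ^ n * (y ^ m * ε m) * (truncSum c (N + 1) m n - truncSum c N m n))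
    (a := fun n m => x / (N + 1) ^ 2 * h n m - if n + m = 0 then (1 - c) * x / (N + 1) ^ 2 else 0)
    (b := fun n m => y / (N + 1) ^ 2 * h n m)
    (fun m => by
      rw [truncSum_succ_succ_zero]
      linear_combination y ^ (m + 1) * truncSum c (N + 1) m 0 * hodd m)
    (fun n => by
      rw [truncSum_succ_zero_succ]
      rcases eq_or_ne n 0 with rfl | hn
      · simp only [hh, hε, Even.zero, if_true, pow_zero, zero_add, pow_one, add_zero]
        ring
      · simp only [hh, hε, hn, Even.zero, if_true, if_false, pow_zero, add_zero]
        ring)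
    (fun n m => by
      rw [truncSum_succ_succ_succ]
      simp only [← add_assoc, Nat.add_eq_zero_iff, one_ne_zero, and_false, if_false]
      linear_combination x ^ (n + 1) * y ^ (m + 1) * truncSum c (N + 1) m (n + 1) * hodd m) w
  have hconst : ∑ p ∈ antidiagonal w,
      (if p.1 + p.2 = 0 then (1 - c) * x / ((N : ℝ) + 1) ^ 2 else 0) =
        if w = 0 then (1 - c) * x / (N + 1) ^ 2 else 0 := by
    rcases eq_or_ne w 0 with rfl | hw
    · simp
    · exact (Finset.sum_congr rfl fun p hp => by rw [mem_antidiagonal.1 hp]).trans (by simp [hw])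
  simp only [mul_sub, Finset.sum_sub_distrib, ← Finset.mul_sum, hconst] at key
  simp only [wordGen]
  linear_combination key

theorem hasSum_of_succ_eq_mul_add {r G : ℝ} {f g : ℕ → ℝ} (hr : |r| < 1) (hg : HasSum g G)
    (h₀ : f 0 = g 0) (hf : ∀ w, f (w + 1) = r * f w + g (w + 1)) : HasSum f (G / (1 - r)) := by
  have hf' (w : ℕ) : f w = ∑ p ∈ antidiagonal w, r ^ p.1 * g p.2 := by
    induction w with
    | zero => simp [h₀]
    | succ w ih =>
      rw [hf, ih, Finset.Nat.sum_antidiagonal_succ, Finset.mul_sum]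
      simp [pow_succ', mul_assoc, add_comm]
  have hr' : Summable fun n => ‖r ^ n‖ := (summable_geometric_of_abs_lt_one hr).norm
  have hsum : Summable f := by
    rw [funext hf']
    exact (summable_norm_sum_mul_antidiagonal_of_summable_norm hr' hg.summable.norm).of_norm
  have htsum := tsum_mul_tsum_eq_tsum_sum_antidiagonal_of_summable_norm hr' hg.summable.norm
  rw [tsum_geometric_of_abs_lt_one hr, hg.tsum_eq, ← tsum_congr hf'] at htsum
  rw [div_eq_inv_mul, htsum]
  exact hsum.hasSum

/-- The recursion in the truncation bound that characterises the generating functions `p` and `q` of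
the truncated sums over the words with an even, respectively odd, number of odd letters. -/
structure IsTransferSolution (c x y : ℝ) (p q : ℕ → ℝ) : Prop where
  even_zero : p 0 = 1
  odd_zero : q 0 = 0
  even_succ (N : ℕ) : (N + 1) ^ 2 * (p (N + 1) - p N) =
    x * (p (N + 1) - (1 - c)) + y / (N + 1) * q (N + 1)
  odd_succ (N : ℕ) : (N + 1) ^ 2 * (q (N + 1) - q N) = x * q (N + 1) + y * (N + 1) * p (N + 1)

namespace IsTransferSolution

variable {c x y : ℝ} {p q : ℕ → ℝ}

theorem neg (h : IsTransferSolution c x y p q) : IsTransferSolution c x (-y) p (-q) where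
  even_zero := h.even_zero
  odd_zero := by simp [h.odd_zero]
  even_succ N := by
    simp only [Pi.neg_apply]
    linear_combination h.even_succ N
  odd_succ N := by
    simp only [Pi.neg_apply]
    linear_combination -h.odd_succ N

theorem hasSum_wordGen_succ (h : IsTransferSolution c x y p q) (hxy : |x + y| < 1) {N : ℕ}
    (ih : ∀ s, HasSum (wordGen c x y s N) (p N + s * q N)) :
    HasSum (wordGen c x y (1 / (N + 1)) (N + 1)) (p (N + 1) + 1 / (N + 1) * q (N + 1)) := by
  have hM : (1 : ℝ) ≤ (N + 1) ^ 2 := one_le_pow₀ (by simp)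
  have hr : |(x + y) / ((N : ℝ) + 1) ^ 2| < 1 := by
    rw [abs_div, abs_of_nonneg (zero_le_one.trans hM), div_lt_one (by positivity)]
    exact hxy.trans_le hM
  have hg := (ih (1 / (N + 1))).sub
    (hasSum_single (f := fun w => if w = 1 then (1 - c) * x / ((N : ℝ) + 1) ^ 2 else 0) 1
      fun w hw => if_neg hw)
  have hsum := hasSum_of_succ_eq_mul_add hr hg (f := wordGen c x y (1 / (N + 1)) (N + 1))
    (by simp [wordGen, truncSum_zero_zero]) fun w => by
      simp only [wordGen_succ_succ, Nat.add_eq_right]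
      ring
  have hr' : 1 - (x + y) / ((N : ℝ) + 1) ^ 2 ≠ 0 := (sub_pos.2 (abs_lt.1 hr).2).ne'
  convert! hsum using 1
  have h₁ := h.even_succ N
  have h₂ := h.odd_succ N
  rw [if_pos rfl, eq_div_iff hr']
  field_simp at h₁ ⊢
  linear_combination h₁ + h₂

theorem hasSum_wordGen (h : IsTransferSolution c x y p q) (hadd : |x + y| < 1) (hsub : |x - y| < 1)
    (s : ℝ) (N : ℕ) : HasSum (wordGen c x y s N) (p N + s * q N) := by
  induction N generalizing s with
  | zero =>
    simp only [h.even_zero, h.odd_zero, mul_zero, add_zero, funext (wordGen_zero c x y s)]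
    exact hasSum_ite_eq 0 1
  | succ N ih =>
    have hM : (N : ℝ) + 1 ≠ 0 := by positivity
    have hpos := h.hasSum_wordGen_succ hadd ih
    have hneg := h.neg.hasSum_wordGen_succ (by rwa [← sub_eq_add_neg]) fun s => by
      simpa [wordGen_neg] using ih (-s)
    rw [wordGen_neg] at hneg
    have hs := (hpos.mul_left ((1 + s * (N + 1)) / 2)).add
      (hneg.mul_left ((1 - s * (N + 1)) / 2))
    convert! hs using 1
    · funext w
      simp only [wordGen, Finset.mul_sum, ← Finset.sum_add_distrib]
      refine Finset.sum_congr rfl fun m _ => ?_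
      split_ifs
      · ring
      · field_simp
        ring
    · simp only [Pi.neg_apply]
      field_simp
      ring

end IsTransferSolution

/-! ### Diagonalising the transfer recursion -/

/-- The ratio `N! ^ 2 / ((N - k)! (N + k)!)`, which vanishes for `k > N`. These are the sequences in
`N` along which the transfer recursion is diagonalised. -/
noncomputable def centralRatio (N k : ℕ) : ℝ :=
  ∏ j ∈ Finset.range k, ((N : ℝ) - j) / (N + j + 1)

theorem centralRatio_zero (N : ℕ) : centralRatio N 0 = 1 := rfl

theorem centralRatio_succ (N k : ℕ) :
    centralRatio N (k + 1) = centralRatio N k * (((N : ℝ) - k) / (N + k + 1)) :=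
  Finset.prod_range_succ _ _

theorem centralRatio_eq_zero {N k : ℕ} (h : N < k) : centralRatio N k = 0 :=
  Finset.prod_eq_zero (Finset.mem_range.2 h) (by simp)

theorem centralRatio_mem_Icc (N k : ℕ) : centralRatio N k ∈ Set.Icc (0 : ℝ) 1 := by
  rcases lt_or_ge N k with h | h
  · simp [centralRatio_eq_zero h]
  · have hj (j : ℕ) (hj : j ∈ Finset.range k) :
        ((N : ℝ) - j) / (N + j + 1) ∈ Set.Icc (0 : ℝ) 1 := by
      have hjN : (j : ℝ) ≤ N := by exact_mod_cast (Finset.mem_range.1 hj).le.trans h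
      exact ⟨div_nonneg (sub_nonneg.2 hjN) (by positivity),
        (div_le_one (by positivity)).2 (by linarith [j.cast_nonneg (α := ℝ)])⟩
    exact ⟨Finset.prod_nonneg fun j h => (hj j h).1,
      Finset.prod_le_one (fun j h => (hj j h).1) fun j h => (hj j h).2⟩

theorem tendsto_centralRatio (k : ℕ) : Tendsto (fun N => centralRatio N k) atTop (𝓝 1) := by
  have h (j : ℕ) : Tendsto (fun N : ℕ => ((N : ℝ) - j) / (N + j + 1)) atTop (𝓝 1) := by
    have hlim : Tendsto (fun N : ℕ => 1 - (2 * (j : ℝ) + 1) / (N + (j + 1))) atTop (𝓝 (1 - 0)) :=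
      tendsto_const_nhds.sub (tendsto_const_nhds.div_atTop
        (tendsto_atTop_add_const_right _ _ tendsto_natCast_atTop_atTop))
    rw [sub_zero] at hlim
    refine hlim.congr fun N => ?_
    rw [← add_assoc]
    have : (N : ℝ) + j + 1 ≠ 0 := by positivity
    field_simp
    ring
  simpa [centralRatio] using tendsto_finsetProd (Finset.range k) fun j _ => h j

theorem sq_sub_sq_mul_centralRatio (N k : ℕ) :
    (((N : ℝ) + 1) ^ 2 - (k : ℝ) ^ 2) * centralRatio (N + 1) k =
      ((N : ℝ) + 1) ^ 2 * centralRatio N k := by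
  induction k with
  | zero => simp [centralRatio_zero]
  | succ k ih =>
    rw [centralRatio_succ, centralRatio_succ, ← mul_assoc _ (centralRatio N k), ← ih]
    push_cast
    have h₁ : (N : ℝ) + 1 + k + 1 ≠ 0 := by positivity
    have h₂ : (N : ℝ) + k + 1 ≠ 0 := by positivity
    field_simp
    ring

theorem sq_mul_sum_centralRatio_sub (N : ℕ) (f : ℕ → ℝ) :
    ((N : ℝ) + 1) ^ 2 * (∑ k ∈ Finset.range (N + 1), f k * centralRatio (N + 1) (k + 1) -
      ∑ k ∈ Finset.range N, f k * centralRatio N (k + 1)) =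
    ∑ k ∈ Finset.range (N + 1), ((k : ℝ) + 1) ^ 2 * f k * centralRatio (N + 1) (k + 1) := by
  have h : ∑ k ∈ Finset.range N, f k * centralRatio N (k + 1) =
      ∑ k ∈ Finset.range (N + 1), f k * centralRatio N (k + 1) := by
    rw [Finset.sum_range_succ, centralRatio_eq_zero (Nat.lt_succ_self N), mul_zero, add_zero]
  rw [h, ← Finset.sum_sub_distrib, Finset.mul_sum]
  refine Finset.sum_congr rfl fun k _ => ?_
  have hk := sq_sub_sq_mul_centralRatio N (k + 1)
  push_cast at hk
  linear_combination f k * hk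

/-- The sequence that is constantly `C 0` plus the increments of `C` weighted by `centralRatio`. It
has the same limit as `C`. -/
noncomputable def ratioSum (C : ℕ → ℝ) (N : ℕ) : ℝ :=
  C 0 + ∑ k ∈ Finset.range N, (C (k + 1) - C k) * centralRatio N (k + 1)

theorem ratioSum_zero (C : ℕ → ℝ) : ratioSum C 0 = C 0 := by simp [ratioSum]

/-- The summation by parts of `N * ratioSum C N`; it arises as the second component of the solution
of the transfer recursion. -/
noncomputable def ratioSumByParts (C : ℕ → ℝ) (N : ℕ) : ℝ :=
  ∑ k ∈ Finset.range N, ((k : ℝ) + 1) * (C (k + 1) + C k) * centralRatio N (k + 1)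

theorem mul_ratioSum (C : ℕ → ℝ) (N : ℕ) : N * ratioSum C N = ratioSumByParts C N := by
  have h (K : ℕ) : N * (C 0 + ∑ k ∈ Finset.range K, (C (k + 1) - C k) * centralRatio N (k + 1)) =
      ∑ k ∈ Finset.range K, ((k : ℝ) + 1) * (C (k + 1) + C k) * centralRatio N (k + 1) +
        ((N : ℝ) - K) * centralRatio N K * C K := by
    induction K with
    | zero => simp [centralRatio_zero]
    | succ K ih =>
      rw [Finset.sum_range_succ, Finset.sum_range_succ, ← add_assoc, mul_add, ih,
        centralRatio_succ]
      have : (N : ℝ) + K + 1 ≠ 0 := by positivity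
      push_cast
      field_simp
      ring
  simpa [ratioSum, ratioSumByParts] using h N

theorem tendsto_ratioSum {C : ℕ → ℝ} {L : ℝ} (hC : Tendsto C atTop (𝓝 L))
    (hs : Summable fun k => |C (k + 1) - C k|) : Tendsto (ratioSum C) atTop (𝓝 L) := by
  have htsum (N : ℕ) : C 0 + ∑' k, (C (k + 1) - C k) * centralRatio N (k + 1) = ratioSum C N := by
    rw [ratioSum, tsum_eq_sum fun k hk => ?_]
    rw [centralRatio_eq_zero (by simpa [Nat.lt_succ_iff] using hk), mul_zero]
  have hlim : Tendsto (fun N => ∑' k, (C (k + 1) - C k) * centralRatio N (k + 1)) atTop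
      (𝓝 (∑' k, (C (k + 1) - C k))) := by
    refine tendsto_tsum_of_dominated_convergence hs (fun k => ?_) (.of_forall fun N k => ?_)
    · simpa using (tendsto_centralRatio (k + 1)).const_mul (C (k + 1) - C k)
    · obtain ⟨h₀, h₁⟩ := centralRatio_mem_Icc N (k + 1)
      rw [Real.norm_eq_abs, abs_mul, abs_of_nonneg h₀]
      exact mul_le_of_le_one_right (abs_nonneg _) h₁
  have htel : ∑' k, (C (k + 1) - C k) = L - C 0 :=
    tendsto_nhds_unique hs.of_abs.hasSum.tendsto_sum_nat
      (by simpa only [Finset.sum_range_sub] using hC.sub_const (C 0))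
  simpa [htel, htsum] using hlim.const_add (C 0)

theorem isTransferSolution_ratioSum {c x y : ℝ} (hy : y ≠ 0) {C E : ℕ → ℝ} (hC₀ : C 0 = 1)
    (hE₀ : E 0 = -(c * x))
    (hsub : ∀ k : ℕ, E (k + 1) - E k = (((k : ℝ) + 1) ^ 2 - x) * (C (k + 1) - C k))
    (hadd : ∀ k : ℕ, (((k : ℝ) + 1) ^ 2 - x) * (E (k + 1) + E k) =
      y ^ 2 * (C (k + 1) + C k)) :
    IsTransferSolution c x y (ratioSum C) fun N => ratioSumByParts E N / y where
  even_zero := by rw [ratioSum_zero, hC₀]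
  odd_zero := by simp [ratioSumByParts]
  even_succ N := by
    have hC := sq_mul_sum_centralRatio_sub N fun k => C (k + 1) - C k
    have hE : ratioSum E (N + 1) = E 0 + ∑ k ∈ Finset.range (N + 1),
        ((k : ℝ) + 1) ^ 2 * (C (k + 1) - C k) * centralRatio (N + 1) (k + 1) -
          x * (ratioSum C (N + 1) - C 0) := by
      simp only [ratioSum, hsub, add_sub_cancel_left, Finset.mul_sum, add_sub_assoc,
        ← Finset.sum_sub_distrib]
      congr 2 with k
      ring
    rw [← mul_ratioSum, hE, hE₀, hC₀, ← hC]
    have hN : (N : ℝ) + 1 ≠ 0 := by positivity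
    simp only [ratioSum, Nat.cast_add, Nat.cast_one, hC₀]
    field_simp
    ring
  odd_succ N := by
    have hE := sq_mul_sum_centralRatio_sub N fun k => ((k : ℝ) + 1) * (E (k + 1) + E k)
    have hC : y ^ 2 * ratioSumByParts C (N + 1) = ∑ k ∈ Finset.range (N + 1), ((k : ℝ) + 1) ^ 2 *
        (((k : ℝ) + 1) * (E (k + 1) + E k)) * centralRatio (N + 1) (k + 1) -
          x * ratioSumByParts E (N + 1) := by
      simp only [ratioSumByParts, Finset.mul_sum, ← Finset.sum_sub_distrib]
      refine Finset.sum_congr rfl fun k _ => ?_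
      linear_combination -((k : ℝ) + 1) * centralRatio (N + 1) (k + 1) * hadd k
    rw [← hE, ← mul_ratioSum] at hC
    simp only [ratioSumByParts, Nat.cast_add, Nat.cast_one] at hC ⊢
    field_simp
    linear_combination -hC

theorem summable_abs_sub_of_bounded {x K : ℝ} (hx : 0 ≤ x) (hx₁ : x < 1) {C E : ℕ → ℝ}
    (hE : ∀ k, |E k| ≤ K)
    (hsub : ∀ k : ℕ, E (k + 1) - E k = (((k : ℝ) + 1) ^ 2 - x) * (C (k + 1) - C k)) :
    Summable fun k => |C (k + 1) - C k| := by
  have hs : Summable fun k : ℕ => 2 * K / (1 - x) * (1 / ((k : ℝ) + 1) ^ 2) := by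
    refine Summable.mul_left _ ?_
    simpa using (summable_nat_add_iff 1).2 (Real.summable_one_div_nat_pow.2 one_lt_two)
  refine Summable.of_nonneg_of_le (fun k => abs_nonneg _) (fun k => ?_) hs
  have hpos : 0 < (1 - x) * ((k : ℝ) + 1) ^ 2 := mul_pos (sub_pos.2 hx₁) (by positivity)
  have hle : (1 - x) * ((k : ℝ) + 1) ^ 2 ≤ ((k : ℝ) + 1) ^ 2 - x := by
    nlinarith [one_le_pow₀ (n := 2) (by simp : (1 : ℝ) ≤ k + 1)]
  rw [div_mul_div_comm, mul_one, le_div_iff₀ hpos]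
  calc |C (k + 1) - C k| * ((1 - x) * ((k : ℝ) + 1) ^ 2)
      ≤ |C (k + 1) - C k| * (((k : ℝ) + 1) ^ 2 - x) := by gcongr
    _ = |E (k + 1) - E k| := by
        rw [hsub, abs_mul, abs_of_pos (hpos.trans_le hle), mul_comm]
    _ ≤ |E (k + 1)| + |E k| := abs_sub _ _
    _ ≤ 2 * K := by linarith [hE k, hE (k + 1)]

/-- The partial product of Euler's product for `sin (π √u) / (π √u)`. -/
noncomputable def sinProd (u : ℝ) (n : ℕ) : ℝ :=
  ∏ j ∈ Finset.range n, (1 - u / ((j : ℝ) + 1) ^ 2)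

/-- The partial product of Euler's product for `tan (π √u / 2) / (π √u / 2)`, with its zeros and
poles interlaced. -/
noncomputable def tanProd (u : ℝ) (n : ℕ) : ℝ :=
  ∏ j ∈ Finset.range n,
    if Even j then (1 - u / ((j : ℝ) + 1) ^ 2)⁻¹ else 1 - u / ((j : ℝ) + 1) ^ 2

/-- The function `tan (π √u / 2) / (π √u / 2)` of `u > 0`. -/
noncomputable def tanc (u : ℝ) : ℝ :=
  Real.tan (Real.pi * √u / 2) / (Real.pi * √u / 2)

theorem one_sub_div_succ_sq_pos {u : ℝ} (hu : u < 1) (j : ℕ) : 0 < 1 - u / ((j : ℝ) + 1) ^ 2 := by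
  rw [sub_pos, div_lt_one (by positivity)]
  exact hu.trans_le (one_le_pow₀ (by simp))

theorem sinProd_pos {u : ℝ} (hu : u < 1) (n : ℕ) : 0 < sinProd u n :=
  Finset.prod_pos fun j _ => one_sub_div_succ_sq_pos hu j

theorem sinProd_succ (u : ℝ) (n : ℕ) :
    sinProd u (n + 1) = sinProd u n * (1 - u / ((n : ℝ) + 1) ^ 2) :=
  Finset.prod_range_succ _ _

theorem tanProd_pos {u : ℝ} (hu : u < 1) (n : ℕ) : 0 < tanProd u n := by
  refine Finset.prod_pos fun j _ => ?_
  have := one_sub_div_succ_sq_pos hu j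
  split_ifs <;> positivity

theorem tanProd_succ (u : ℝ) (n : ℕ) : tanProd u (n + 1) = tanProd u n *
    if Even n then (1 - u / ((n : ℝ) + 1) ^ 2)⁻¹ else 1 - u / ((n : ℝ) + 1) ^ 2 :=
  Finset.prod_range_succ _ _

theorem tanProd_eq {u : ℝ} (hu : u < 1) (n : ℕ) :
    tanProd u n = sinProd (u / 4) (n / 2) ^ 2 / sinProd u n := by
  induction n with
  | zero => simp [tanProd, sinProd]
  | succ n ih =>
    have hn := (one_sub_div_succ_sq_pos hu n).ne'
    have hs := (sinProd_pos hu n).ne'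
    rw [tanProd_succ, ih, sinProd_succ u n]
    rcases Nat.even_or_odd' n with ⟨k, rfl | rfl⟩
    · rw [show (2 * k + 1) / 2 = 2 * k / 2 by omega, if_pos (even_two_mul k)]
      field_simp
    · rw [if_neg (Nat.not_even_two_mul_add_one k), show (2 * k + 1 + 1) / 2 = k + 1 by omega,
        show (2 * k + 1) / 2 = k by omega, sinProd_succ (u / 4)]
      have hk : u / 4 / ((k : ℝ) + 1) ^ 2 = u / (((2 * k + 1 : ℕ) : ℝ) + 1) ^ 2 := by
        rw [div_div]
        push_cast
        ring
      rw [hk]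
      field_simp

theorem tendsto_sinProd {u : ℝ} (hu : 0 < u) :
    Tendsto (sinProd u) atTop (𝓝 (Real.sin (Real.pi * √u) / (Real.pi * √u))) := by
  have hu' : Real.pi * √u ≠ 0 := by positivity
  refine ((Real.tendsto_euler_sin_prod √u).div_const (Real.pi * √u)).congr fun n => ?_
  rw [mul_div_cancel_left₀ _ hu', Real.sq_sqrt hu.le, sinProd]

theorem pi_mul_sqrt_half_mem_Ioo {u : ℝ} (hu : 0 < u) (hu₁ : u < 1) :
    Real.pi * √u / 2 ∈ Set.Ioo 0 (Real.pi / 2) := by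
  have : √u < 1 := (Real.sqrt_lt' one_pos).2 (by simpa)
  exact ⟨by positivity, by nlinarith [Real.pi_pos]⟩

theorem tanc_pos {u : ℝ} (hu : 0 < u) (hu₁ : u < 1) : 0 < tanc u := by
  obtain ⟨h₀, h₁⟩ := pi_mul_sqrt_half_mem_Ioo hu hu₁
  exact div_pos (Real.tan_pos_of_pos_of_lt_pi_div_two h₀ h₁) h₀

theorem tendsto_tanProd {u : ℝ} (hu : 0 < u) (hu₁ : u < 1) :
    Tendsto (tanProd u) atTop (𝓝 (tanc u)) := by
  obtain ⟨h₀, h₁⟩ := pi_mul_sqrt_half_mem_Ioo hu hu₁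
  have hz : Real.pi * √(u / 4) = Real.pi * √u / 2 := by
    rw [Real.sqrt_div' _ (by norm_num), show (4 : ℝ) = 2 ^ 2 by norm_num,
      Real.sqrt_sq zero_le_two, mul_div_assoc]
  have hdouble : Real.pi * √u = 2 * (Real.pi * √u / 2) := by ring
  have hquarter := tendsto_sinProd (u := u / 4) (by positivity)
  have hfull := tendsto_sinProd hu
  rw [hz] at hquarter
  rw [hdouble] at hfull
  unfold tanc
  set z := Real.pi * √u / 2
  have hsin : Real.sin z ≠ 0 := (Real.sin_pos_of_pos_of_lt_pi h₀ (by linarith)).ne'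
  have hcos : Real.cos z ≠ 0 := (Real.cos_pos_of_mem_Ioo ⟨by linarith, h₁⟩).ne'
  rw [Real.sin_two_mul] at hfull
  have hlim := ((hquarter.comp (Nat.tendsto_div_const_atTop two_ne_zero)).pow 2).div hfull
    (by positivity)
  convert! hlim.congr fun n => (tanProd_eq hu₁ n).symm using 2
  rw [Real.tan_eq_sin_div_cos]
  field_simp

/-- The quotient of two partial tangent products. -/
noncomputable def tanRatio (x y : ℝ) (k : ℕ) : ℝ :=
  tanProd (x + y) k / tanProd (x - y) k

/-- The coefficients of the expansion of the even component of the solution of the transfer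
recursion, where `t` accounts for the weight of the words ending in `2`. -/
noncomputable def evenCoeff (x y t : ℝ) (k : ℕ) : ℝ :=
  ((1 + t) * tanRatio x y k + (1 - t) / tanRatio x y k) / 2

/-- The coefficients of the odd component that corresponds to `evenCoeff`. -/
noncomputable def oddCoeff (x y t : ℝ) (k : ℕ) : ℝ :=
  (-1) ^ k * y * ((1 - t) / tanRatio x y k - (1 + t) * tanRatio x y k) / 2

section Coeff

variable {x y : ℝ}

theorem tanRatio_pos (hxy : x + y < 1) (hxy' : x - y < 1) (k : ℕ) : 0 < tanRatio x y k :=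
  div_pos (tanProd_pos hxy k) (tanProd_pos hxy' k)

theorem tanRatio_succ (x y : ℝ) (k : ℕ) : tanRatio x y (k + 1) = tanRatio x y k *
    if Even k then (((k : ℝ) + 1) ^ 2 - (x - y)) / (((k : ℝ) + 1) ^ 2 - (x + y))
    else (((k : ℝ) + 1) ^ 2 - (x + y)) / (((k : ℝ) + 1) ^ 2 - (x - y)) := by
  have hk : ((k : ℝ) + 1) ^ 2 ≠ 0 := by positivity
  simp only [tanRatio, tanProd_succ, mul_div_mul_comm, one_sub_div hk]
  split_ifs
  · rw [inv_div_inv, div_div_div_cancel_right₀ hk]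
  · rw [div_div_div_cancel_right₀ hk]

theorem oddCoeff_sub_and_add (hxy : x + y < 1) (hxy' : x - y < 1) (t : ℝ) (k : ℕ) :
    oddCoeff x y t (k + 1) - oddCoeff x y t k =
        (((k : ℝ) + 1) ^ 2 - x) * (evenCoeff x y t (k + 1) - evenCoeff x y t k) ∧
      (((k : ℝ) + 1) ^ 2 - x) * (oddCoeff x y t (k + 1) + oddCoeff x y t k) =
        y ^ 2 * (evenCoeff x y t (k + 1) + evenCoeff x y t k) := by
  have hR := (tanRatio_pos hxy hxy' k).ne'
  have hm : (1 : ℝ) ≤ ((k : ℝ) + 1) ^ 2 := one_le_pow₀ (by simp)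
  have hu : ((k : ℝ) + 1) ^ 2 - (x + y) ≠ 0 := by linarith
  have hv : ((k : ℝ) + 1) ^ 2 - (x - y) ≠ 0 := by linarith
  simp only [oddCoeff, evenCoeff, tanRatio_succ]
  set R := tanRatio x y k
  set m := ((k : ℝ) + 1) ^ 2
  rcases Nat.even_or_odd k with hk | hk
  · rw [if_pos hk, hk.neg_one_pow, hk.add_one.neg_one_pow]
    constructor <;> field_simp <;> ring
  · rw [if_neg (Nat.not_even_iff_odd.2 hk), hk.neg_one_pow, hk.add_one.neg_one_pow]
    constructor <;> field_simp <;> ring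

theorem exists_isTransferSolution_tendsto (c : ℝ) (hy : 0 < y) (hyx : y < x) (hxy : x + y < 1) :
    ∃ p q, IsTransferSolution c x y p q ∧ Tendsto p atTop
      (𝓝 (((1 + c * x / y) * (tanc (x + y) / tanc (x - y)) +
        (1 - c * x / y) / (tanc (x + y) / tanc (x - y))) / 2)) := by
  have hxy' : x - y < 1 := by linarith
  set t := c * x / y with ht
  have hrel := oddCoeff_sub_and_add hxy hxy' t
  have hratio : Tendsto (tanRatio x y) atTop (𝓝 (tanc (x + y) / tanc (x - y))) :=
    (tendsto_tanProd (by linarith) hxy).div (tendsto_tanProd (by linarith) hxy')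
      (tanc_pos (by linarith) hxy').ne'
  have hne : tanc (x + y) / tanc (x - y) ≠ 0 :=
    (div_pos (tanc_pos (by linarith) hxy) (tanc_pos (by linarith) hxy')).ne'
  have hlim : Tendsto (evenCoeff x y t) atTop (𝓝 (((1 + t) * (tanc (x + y) / tanc (x - y)) +
      (1 - t) / (tanc (x + y) / tanc (x - y))) / 2)) :=
    ((hratio.const_mul _).add (tendsto_const_nhds.div hratio hne)).div_const 2
  obtain ⟨K, hK⟩ : ∃ K, ∀ k, |oddCoeff x y t k| ≤ K := by
    obtain ⟨K, hK⟩ := (((tendsto_const_nhds (x := 1 - t)).div hratio hne).sub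
      (hratio.const_mul (1 + t))).abs.bddAbove_range
    refine ⟨y * K / 2, fun k => ?_⟩
    simp only [oddCoeff, abs_div, abs_mul, abs_pow, abs_neg, abs_one, one_pow, one_mul, abs_two,
      abs_of_pos hy]
    gcongr
    exact hK ⟨k, rfl⟩
  refine ⟨_, _, isTransferSolution_ratioSum hy.ne' ?_ ?_ (fun k => (hrel k).1)
    fun k => (hrel k).2, tendsto_ratioSum hlim
      (summable_abs_sub_of_bounded (by linarith) (by linarith) hK fun k => (hrel k).1)⟩
  · simp [evenCoeff, tanRatio, tanProd]
  · simp only [oddCoeff, tanRatio, tanProd, Finset.prod_range_zero, ht, pow_zero, div_one]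
    field_simp
    ring

end Coeff

/-! ### Power series of the tangent and the cotangent -/

theorem hasSum_swap_of_nonneg {f : ℕ → ℕ → ℝ} (hf : ∀ m n, 0 ≤ f m n) {r c : ℕ → ℝ} {s : ℝ}
    (hr : ∀ m, HasSum (f m) (r m)) (hs : HasSum r s) (hc : ∀ n, HasSum (fun m => f m n) (c n)) :
    HasSum c s := by
  have hsum : Summable (Function.uncurry f) := by
    refine (summable_prod_of_nonneg fun p => hf p.1 p.2).2 ⟨fun m => (hr m).summable, ?_⟩
    exact hs.summable.congr fun m => (hr m).tsum_eq.symm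
  have htot : HasSum (Function.uncurry f) s :=
    (hsum.hasSum.prod_fiberwise hr).unique hs ▸ hsum.hasSum
  exact ((Equiv.prodComm ℕ ℕ).hasSum_iff.2 htot).prod_fiberwise hc

theorem ofReal_mem_integerComplement {x : ℝ} (hx : 0 < x) (hx₁ : x < 1) :
    (x : ℂ) ∈ Complex.integerComplement := by
  rw [Complex.mem_integerComplement_iff]
  rintro ⟨n, hn⟩
  obtain rfl : (n : ℝ) = x := mod_cast hn
  have h₀ : 0 < n := mod_cast hx
  have h₁ : n < 1 := mod_cast hx₁
  omega

theorem hasSum_one_sub_pi_mul_cot {x : ℝ} (hx : 0 < x) (hx₁ : x < 1) :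
    HasSum (fun n : ℕ => 2 * x ^ 2 / (((n : ℝ) + 1) ^ 2 - x ^ 2))
      (1 - Real.pi * x * Real.cot (Real.pi * x)) := by
  have hmem := ofReal_mem_integerComplement hx hx₁
  have hx₀ : (x : ℂ) ≠ 0 := mod_cast hx.ne'
  have hsum : HasSum (cotTerm x) (Real.pi * Complex.cot (Real.pi * x) - 1 / x) :=
    (summable_cotTerm hmem).hasSum_iff_tendsto_nat.2 (tendsto_logDeriv_euler_cot_sub hmem)
  rw [← Complex.hasSum_ofReal]
  convert! hsum.mul_left (-(x : ℂ)) using 1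
  · funext n
    have hn : 0 < ((n : ℝ) + 1) ^ 2 - x ^ 2 := by nlinarith [n.cast_nonneg (α := ℝ)]
    have hn' : ((n : ℂ) + 1) ^ 2 - (x : ℂ) ^ 2 ≠ 0 := mod_cast hn.ne'
    rw [cotTerm_identity hmem,
      show ((x : ℂ) + (n + 1)) * (x - (n + 1)) = -(((n : ℂ) + 1) ^ 2 - x ^ 2) by ring]
    push_cast
    field_simp
  · push_cast
    field_simp
    ring

/-- The coefficient of `u ^ m` in the expansion of `(tanc u)⁻¹`. -/
noncomputable def cotCoeff (m : ℕ) : ℝ :=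
  (-1) ^ m * Real.pi ^ (2 * m) * (bernoulli (2 * m) / (2 * m).factorial)

/-- The coefficient of `u ^ k` in the expansion of `tanc u`. -/
noncomputable def tanCoeff (k : ℕ) : ℝ :=
  4 * (-1) ^ k * Real.pi ^ (2 * k) * (4 ^ (k + 1) - 1) *
    (bernoulli (2 * k + 2) / (2 * k + 2).factorial)

theorem hasSum_two_mul_div_pow_succ {v m : ℝ} (hv : 0 ≤ v) (hvm : v < m) :
    HasSum (fun k => 2 * (v / m) ^ (k + 1)) (2 * v / (m - v)) := by
  have hm : 0 < m := hv.trans_lt hvm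
  have hgeom := (hasSum_geometric_of_lt_one (div_nonneg hv hm.le) ((div_lt_one hm).2 hvm)).mul_left
    (2 * (v / m))
  convert! hgeom using 1
  · funext k
    ring
  · rw [one_sub_div hm.ne']
    field_simp

theorem hasSum_two_mul_div_succ_sq_pow (u : ℝ) (k : ℕ) :
    HasSum (fun n : ℕ => 2 * (u / 4 / ((n : ℝ) + 1) ^ 2) ^ (k + 1))
      (-(cotCoeff (k + 1) * u ^ (k + 1))) := by
  have hzeta := ((hasSum_nat_add_iff' 1).2 (hasSum_zeta_nat k.succ_ne_zero)).mul_left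
    (2 * (u / 4) ^ (k + 1))
  convert! hzeta using 1
  · funext n
    rw [div_pow, ← pow_mul, mul_one_div, Nat.cast_add_one, mul_div_assoc]
  · rw [Finset.sum_range_one, Nat.cast_zero, zero_pow (by positivity), div_zero, sub_zero,
      Nat.succ_eq_add_one, show 2 * (k + 1) - 1 = 2 * k + 1 by omega, div_pow,
      show (4 : ℝ) = 2 ^ 2 by norm_num, ← pow_mul, cotCoeff]
    field_simp
    ring

theorem hasSum_cotCoeff {u : ℝ} (hu : 0 < u) (hu₄ : u < 4) :
    HasSum (fun m => cotCoeff m * u ^ m) (tanc u)⁻¹ := by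
  have hsqrt : (√u / 2) ^ 2 = u / 4 := by
    rw [div_pow, Real.sq_sqrt hu.le]
    norm_num
  have hlt : √u / 2 < 1 := by
    rw [div_lt_one two_pos, Real.sqrt_lt' two_pos]
    linarith
  have hcot := hasSum_one_sub_pi_mul_cot (by positivity) hlt
  rw [hsqrt, mul_div_assoc' Real.pi, ← Real.tan_inv_eq_cot] at hcot
  have hrow (n : ℕ) : u / 4 < ((n : ℝ) + 1) ^ 2 := by nlinarith [n.cast_nonneg (α := ℝ)]
  have hswap := (hasSum_swap_of_nonneg (fun _ _ => by positivity)
    (fun n => hasSum_two_mul_div_pow_succ (by positivity) (hrow n)) hcot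
    (hasSum_two_mul_div_succ_sq_pow u)).neg
  have hzero : cotCoeff 0 = 1 := by simp [cotCoeff]
  rw [← hasSum_nat_add_iff' 1, Finset.sum_range_one, hzero, pow_zero, one_mul, tanc, inv_div,
    div_eq_mul_inv]
  simpa only [neg_neg, neg_sub] using hswap

theorem inv_tanc_sub_inv_tanc_four_mul {u : ℝ} (hu : 0 < u) (hu₁ : u < 1) :
    (tanc u)⁻¹ - (tanc (4 * u))⁻¹ = (Real.pi * √u / 2) ^ 2 * tanc u := by
  obtain ⟨h₀, h₁⟩ := pi_mul_sqrt_half_mem_Ioo hu hu₁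
  have hsqrt : √(4 * u) = 2 * √u := by
    rw [Real.sqrt_mul zero_le_four, show (4 : ℝ) = 2 ^ 2 by norm_num, Real.sqrt_sq zero_le_two]
  rw [tanc, tanc, hsqrt, show Real.pi * (2 * √u) / 2 = 2 * (Real.pi * √u / 2) by ring]
  set z := Real.pi * √u / 2
  have htan : Real.tan z ≠ 0 := (Real.tan_pos_of_pos_of_lt_pi_div_two h₀ h₁).ne'
  rw [Real.tan_two_mul, inv_div, inv_div, div_div_eq_mul_div]
  field_simp
  ring

theorem hasSum_tanCoeff {u : ℝ} (hu : 0 < u) (hu₁ : u < 1) :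
    HasSum (fun k => tanCoeff k * u ^ k) (tanc u) := by
  have hdiff := (hasSum_cotCoeff hu (by linarith)).sub
    (hasSum_cotCoeff (u := 4 * u) (by linarith) (by linarith))
  rw [← hasSum_nat_add_iff' 1, Finset.sum_range_one, pow_zero, pow_zero, sub_self, sub_zero,
    inv_tanc_sub_inv_tanc_four_mul hu hu₁, div_pow, mul_pow, Real.sq_sqrt hu.le] at hdiff
  convert! hdiff.mul_left (Real.pi ^ 2 * u / 2 ^ 2)⁻¹ using 1
  · funext k
    rw [tanCoeff, cotCoeff, show 2 * (k + 1) = 2 * k + 2 by ring, mul_pow]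
    field_simp
    ring
  · field_simp

/-! ### Passage to the limit -/

theorem hasSum_of_monotone_of_tendsto {f : ℕ → ℕ → ℝ} {g p : ℕ → ℝ} {L : ℝ}
    (hf₀ : ∀ N w, 0 ≤ f N w) (hf : ∀ w, Monotone fun N => f N w)
    (hg : ∀ w, Tendsto (fun N => f N w) atTop (𝓝 (g w)))
    (hp : ∀ N, HasSum (f N) (p N)) (hL : Tendsto p atTop (𝓝 L)) : HasSum g L := by
  have hfg (N w : ℕ) : f N w ≤ g w := (hf w).ge_of_tendsto (hg w) N
  have hle (W : ℕ) : ∑ w ∈ Finset.range W, g w ≤ L :=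
    le_of_tendsto_of_tendsto' (tendsto_finsetSum _ fun w _ => hg w) hL fun N =>
      sum_le_hasSum _ (fun w _ => hf₀ N w) (hp N)
  have hsum : Summable g := summable_of_sum_range_le (fun w => (hf₀ 0 w).trans (hfg 0 w)) hle
  have hge : L ≤ ∑' w, g w := le_of_tendsto' hL fun N => hasSum_le (hfg N) (hp N) hsum.hasSum
  exact (hsum.tsum_le_of_sum_range_le hle).antisymm hge ▸ hsum.hasSum

theorem eq_zero_of_hasSum_mul_pow_zero {a : ℕ → ℝ} {ε : ℝ} (hε : 0 < ε)
    (ha : ∀ z ∈ Set.Ioo 0 ε, HasSum (fun w => a w * z ^ w) 0) (w : ℕ) : a w = 0 := by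
  set P := FormalMultilinearSeries.ofScalars ℝ a
  lift ε to NNReal using hε.le
  have hrad : ((ε / 2 : NNReal) : ENNReal) ≤ P.radius := by
    refine P.le_radius_of_summable ?_
    simpa only [P, FormalMultilinearSeries.ofScalars_norm, norm_mul, norm_pow, NNReal.norm_eq]
      using (ha (ε / 2 : NNReal) ⟨by simpa using hε, by simpa using hε⟩).summable.norm
  have hpos : (0 : ENNReal) < (ε / 2 : NNReal) := mod_cast half_pos (mod_cast hε : 0 < ε)
  have hP : HasFPowerSeriesAt P.sum P 0 :=
    (P.hasFPowerSeriesOnBall (hpos.trans_le hrad)).hasFPowerSeriesAt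
  have hzero : ∀ᶠ z in 𝓝[>] (0 : ℝ), P.sum z = 0 := by
    filter_upwards [Ioo_mem_nhdsGT hε] with z hz
    simpa [P, FormalMultilinearSeries.sum, FormalMultilinearSeries.ofScalars_apply_eq, mul_comm]
      using (ha z hz).tsum_eq
  have hev : ∀ᶠ z in 𝓝 (0 : ℝ), P.sum z = 0 :=
    hP.analyticAt.frequently_zero_iff_eventually_zero.1
      (hzero.frequently.filter_mono (nhdsWithin_mono _ fun z hz => ne_of_gt hz))
  exact congrFun ((FormalMultilinearSeries.ofScalars_series_eq_zero ℝ).1 (hP.congr hev).eq_zero) w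

section Limit

open Polynomial

variable {c x y : ℝ}

theorem wordGen_zero_nonneg (hc : 0 ≤ c) (hx : 0 ≤ x) (hy : 0 ≤ y) (N w : ℕ) :
    0 ≤ wordGen c x y 0 N w := by
  refine Finset.sum_nonneg fun p _ => mul_nonneg (mul_nonneg (pow_nonneg hx _) ?_)
    (truncSum_nonneg hc _ _ _)
  split_ifs <;> positivity

theorem monotone_wordGen_zero (hc : 0 ≤ c) (hx : 0 ≤ x) (hy : 0 ≤ y) (w : ℕ) :
    Monotone fun N => wordGen c x y 0 N w := by
  refine fun M N hMN => Finset.sum_le_sum fun p _ => mul_le_mul_of_nonneg_left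
    (monotone_truncSum hc _ _ hMN) (mul_nonneg (pow_nonneg hx _) ?_)
  split_ifs <;> positivity

theorem mul_truncSum_le_wordGen_zero (hc : 0 ≤ c) (hx : 0 ≤ x) (hy : 0 ≤ y) {m : ℕ} (hm : Even m)
    (n N : ℕ) : x ^ n * y ^ m * truncSum c N m n ≤ wordGen c x y 0 N (n + m) := by
  have hle := Finset.single_le_sum
    (f := fun p : ℕ × ℕ =>
      x ^ p.1 * (y ^ p.2 * if Even p.2 then 1 else 0) * truncSum c N p.2 p.1)
    (fun p _ => mul_nonneg (mul_nonneg (pow_nonneg hx _) (by split_ifs <;> positivity))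
      (truncSum_nonneg hc _ _ _)) (mem_antidiagonal.2 (rfl : (n, m).1 + (n, m).2 = n + m))
  simpa only [wordGen, if_pos hm, mul_one] using hle

theorem exists_hasSum_wordGen_zero (c : ℝ) (hy : 0 < y) (hyx : y < x) (hxy : x + y < 1) :
    ∃ p, (∀ N, HasSum (wordGen c x y 0 N) (p N)) ∧ Tendsto p atTop
      (𝓝 (((1 + c * x / y) * (tanc (x + y) / tanc (x - y)) +
        (1 - c * x / y) / (tanc (x + y) / tanc (x - y))) / 2)) := by
  obtain ⟨p, q, hpq, hp⟩ := exists_isTransferSolution_tendsto c hy hyx hxy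
  refine ⟨p, fun N => ?_, hp⟩
  simpa only [zero_mul, add_zero] using hpq.hasSum_wordGen
    (abs_lt.2 ⟨by linarith, hxy⟩) (abs_lt.2 ⟨by linarith, by linarith⟩) 0 N

theorem bddAbove_truncSum (hc : 0 ≤ c) {m : ℕ} (hm : Even m) (n : ℕ) :
    BddAbove (Set.range fun N => truncSum c N m n) := by
  obtain ⟨p, hp, hlim⟩ := exists_hasSum_wordGen_zero (x := 1 / 2) (y := 1 / 4) c
    (by norm_num) (by norm_num) (by norm_num)
  obtain ⟨K, hK⟩ := hlim.bddAbove_range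
  refine ⟨K / ((1 / 2) ^ n * (1 / 4) ^ m), ?_⟩
  rintro _ ⟨N, rfl⟩
  rw [le_div_iff₀' (by positivity)]
  calc (1 / 2) ^ n * (1 / 4) ^ m * truncSum c N m n
      ≤ wordGen c (1 / 2) (1 / 4) 0 N (n + m) :=
        mul_truncSum_le_wordGen_zero hc (by norm_num) (by norm_num) hm n N
    _ ≤ p N := le_hasSum (hp N) _ fun w _ => wordGen_zero_nonneg hc (by norm_num) (by norm_num) N w
    _ ≤ K := hK ⟨N, rfl⟩

theorem tendsto_truncSum_iSup (hc : 0 ≤ c) {m : ℕ} (hm : Even m) (n : ℕ) :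
    Tendsto (fun N => truncSum c N m n) atTop (𝓝 (⨆ N, truncSum c N m n)) :=
  tendsto_atTop_ciSup (monotone_truncSum hc m n) (bddAbove_truncSum hc hm n)

theorem summable_zetaStarTerm_word321_append (d : ℕ) (a : Fin (2 * d) → ℕ) (b : ℕ) :
    Summable (zetaStarTerm (word321 d a ++ List.replicate b 2)) := by
  obtain ⟨K, hK⟩ := bddAbove_truncSum zero_le_one (even_two_mul d) (∑ i, a i + b)
  refine summable_zetaStarTerm_of_truncZetaStar_le (c := K) fun N => ?_
  exact (le_wordSum_of_nonneg (fun l => truncZetaStar_nonneg l N) d a b).trans (hK ⟨N, rfl⟩)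

/-- The polynomial in `x / y` that collects the limits of the coefficients of `wordGen c x y 0`
in degree `w`. -/
noncomputable def limitPoly (c : ℝ) (w : ℕ) : ℝ[X] :=
  ∑ p ∈ antidiagonal w, C (if Even p.2 then ⨆ N, truncSum c N p.2 p.1 else 0) * X ^ p.1

/-- The polynomial in `x / y` that collects the terms of degree `w` of the double power series of
`tanc (x + y) / tanc (x - y)`. -/
noncomputable def tancPoly (w : ℕ) : ℝ[X] :=
  ∑ p ∈ antidiagonal w, C (tanCoeff p.1 * cotCoeff p.2) * ((X + 1) ^ p.1 * (X - 1) ^ p.2)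

theorem coeff_limitPoly (c : ℝ) {m : ℕ} (hm : Even m) (n : ℕ) :
    (limitPoly c (n + m)).coeff n = ⨆ N, truncSum c N m n := by
  simp only [limitPoly, finsetSum_coeff, coeff_C_mul_X_pow]
  rw [Finset.sum_eq_single (n, m), if_pos rfl, if_pos hm]
  · rintro ⟨i, j⟩ hp hne
    rw [mem_antidiagonal] at hp
    exact if_neg fun h : n = i => hne (Prod.ext h.symm (by grind))
  · exact fun h => (h (mem_antidiagonal.2 rfl)).elim

theorem tendsto_wordGen_zero (hc : 0 ≤ c) (τ lam : ℝ) (w : ℕ) :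
    Tendsto (fun N => wordGen c (lam * τ) lam 0 N w) atTop
      (𝓝 ((limitPoly c w).eval τ * lam ^ w)) := by
  rw [limitPoly, eval_finsetSum, Finset.sum_mul]
  refine tendsto_finsetSum _ fun p hp => ?_
  rw [← mem_antidiagonal.1 hp, eval_C_mul, eval_X_pow, pow_add]
  split_ifs with h
  · have hlim := (tendsto_truncSum_iSup hc h p.1).const_mul ((lam * τ) ^ p.1 * (lam ^ p.2 * 1))
    convert! hlim using 2
    ring
  · simp only [mul_zero, zero_mul, tendsto_const_nhds]

theorem hasSum_eval_tancPoly {τ lam : ℝ} (hadd : lam * (τ + 1) ∈ Set.Ioo 0 1)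
    (hsub : lam * (τ - 1) ∈ Set.Ioo 0 1) :
    HasSum (fun w => (tancPoly w).eval τ * lam ^ w)
      (tanc (lam * (τ + 1)) / tanc (lam * (τ - 1))) := by
  have htan := hasSum_tanCoeff hadd.1 hadd.2
  have hcot := hasSum_cotCoeff hsub.1 (by linarith [hsub.2])
  have hprod := (summable_norm_sum_mul_antidiagonal_of_summable_norm htan.summable.norm
    hcot.summable.norm).of_norm.hasSum
  rw [← tsum_mul_tsum_eq_tsum_sum_antidiagonal_of_summable_norm htan.summable.norm
    hcot.summable.norm, htan.tsum_eq, hcot.tsum_eq, ← div_eq_mul_inv] at hprod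
  refine hprod.congr_fun fun w => ?_
  rw [tancPoly, eval_finsetSum, Finset.sum_mul]
  refine Finset.sum_congr rfl fun p hp => ?_
  rw [← mem_antidiagonal.1 hp]
  simp only [eval_mul, eval_add, eval_sub, eval_pow, eval_X, eval_C, eval_one, mul_pow, pow_add]
  ring

theorem eval_limitPoly_add_self (hc : 0 ≤ c) {τ : ℝ} (hτ : 1 < τ) (w : ℕ) :
    (limitPoly c w).eval τ + (limitPoly c w).eval τ = (1 + c * τ) * (tancPoly w).eval τ +
      (-1) ^ w * ((1 - c * τ) * (tancPoly w).eval (-τ)) := by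
  rw [← sub_eq_zero]
  revert w
  refine eq_zero_of_hasSum_mul_pow_zero (ε := 1 / (τ + 1)) (by positivity)
    fun lam ⟨hlam, hlt⟩ => ?_
  rw [lt_div_iff₀ (by linarith)] at hlt
  have hsub : 0 < lam * (τ - 1) := mul_pos hlam (by linarith)
  obtain ⟨p, hp, hlim⟩ := exists_hasSum_wordGen_zero (x := lam * τ) (y := lam) c hlam
    (by linarith) (by linarith)
  have hleft := hasSum_of_monotone_of_tendsto
    (wordGen_zero_nonneg hc (by positivity) hlam.le)
    (monotone_wordGen_zero hc (by positivity) hlam.le) (tendsto_wordGen_zero hc τ lam) hp hlim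
  have hpos := (hasSum_eval_tancPoly (τ := τ) (lam := lam) ⟨by positivity, hlt⟩
    ⟨hsub, by linarith⟩).mul_left (1 + c * τ)
  have hneg := (hasSum_eval_tancPoly (τ := -τ) (lam := -lam)
    ⟨by linarith, by linarith⟩ ⟨by linarith, by linarith⟩).mul_left (1 - c * τ)
  convert! (hleft.add hleft).sub (hpos.add hneg) using 1
  · funext w
    rw [neg_pow lam]
    ring
  · rw [show lam * τ + lam = lam * (τ + 1) by ring, show lam * τ - lam = lam * (τ - 1) by ring,
      show -lam * (-τ + 1) = lam * (τ - 1) by ring, show -lam * (-τ - 1) = lam * (τ + 1) by ring,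
      show c * (lam * τ) / lam = c * τ by field_simp, div_div_eq_mul_div]
    ring

theorem tendsto_truncSum_coeff (hc : 0 ≤ c) {m : ℕ} (hm : Even m) (n : ℕ) :
    Tendsto (fun N => truncSum c N m n) atTop
      (𝓝 (((1 + C c * X) * tancPoly (n + m)).coeff n)) := by
  set P := (1 + C c * X) * tancPoly (n + m)
  have hpoly : limitPoly c (n + m) + limitPoly c (n + m) =
      P + C ((-1) ^ (n + m)) * P.comp (C (-1) * X) := by
    refine eq_of_infinite_eval_eq _ _ ((Set.Ioi_infinite (1 : ℝ)).mono fun τ hτ => ?_)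
    simpa [P, sub_eq_add_neg] using eval_limitPoly_add_self hc hτ (n + m)
  have hsign : (-1 : ℝ) ^ (n + m) * (-1) ^ n = 1 := by
    rw [← pow_add, Even.neg_one_pow (by grind)]
  have hcoeff := congrArg (coeff · n) hpoly
  simp only [coeff_add, coeff_C_mul, comp_C_mul_X_coeff, coeff_limitPoly c hm] at hcoeff
  convert! tendsto_truncSum_iSup hc hm n using 2
  linear_combination (-hcoeff - P.coeff n * hsign) / 2

end Limit

/-! ### Comparison of coefficients -/

section Coeff

open Polynomial

theorem ZStar₀_eq_coeff (d n : ℕ) : ZStar₀ d n = (tancPoly (n + 2 * d)).coeff n := by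
  have hlim := tendsto_truncSum_coeff le_rfl (even_two_mul d) n
  rw [C_0, zero_mul, add_zero, one_mul] at hlim
  refine tendsto_nhds_unique ?_ hlim
  simp only [truncSum, ← sum_word321]
  refine tendsto_finsetSum _ fun a _ => tendsto_truncZetaStar ?_
  have hsum := summable_zetaStarTerm_word321_append d a 0
  rwa [List.replicate_zero, List.append_nil] at hsum

theorem ZStar_eq_coeff (d n : ℕ) : ZStar d n = ((X + 1) * tancPoly (n + 2 * d)).coeff n := by
  have hlim := tendsto_truncSum_coeff zero_le_one (even_two_mul d) n
  rw [C_1, one_mul, add_comm 1] at hlim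
  refine tendsto_nhds_unique ?_ hlim
  simp only [truncSum, ← sum_word321_append]
  exact tendsto_finsetSum _ fun a _ =>
    tendsto_truncZetaStar (summable_zetaStarTerm_word321_append d _ _)

theorem ZStar₁_succ_eq_coeff (d n : ℕ) :
    ZStar₁ d (n + 1) = (tancPoly (n + 1 + 2 * d)).coeff n := by
  have hadd := ZStar_eq_add d (n + 1)
  rw [ZStar_eq_coeff, ZStar₀_eq_coeff, add_mul, one_mul, coeff_add, coeff_X_mul] at hadd
  linarith

theorem coeff_X_add_one_pow_mul_X_sub_one_pow {R : Type*} [CommRing R] (k m n : ℕ) :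
    ((X + 1) ^ k * (X - 1) ^ m : R[X]).coeff n =
      ∑ r ∈ Finset.range (n + 1), (-1) ^ (m + n + r) * (k.choose r : R) * m.choose (n - r) := by
  rw [coeff_mul, Finset.Nat.sum_antidiagonal_eq_sum_range_succ_mk]
  refine Finset.sum_congr rfl fun r hr => ?_
  rw [coeff_X_add_one_pow, sub_eq_add_neg, ← C_1, ← C_neg, coeff_X_add_C_pow]
  rcases le_or_gt (n - r) m with h | h
  · have hsign : (-1 : R) ^ (m + n + r) = (-1) ^ (m - (n - r)) := by
      rw [show m + n + r = m - (n - r) + 2 * n by grind, pow_add, (even_two_mul n).neg_one_pow,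
        mul_one]
    rw [hsign]
    ring
  · simp only [Nat.choose_eq_zero_of_lt h, Nat.cast_zero, mul_zero]

theorem coeff_X_add_one_pow_mul_tancPoly (δ w n : ℕ) :
    ((X + 1) ^ δ * tancPoly w).coeff n = 4 * Real.pi ^ (2 * w) *
      ∑ k ∈ Finset.range (w + 1), ∑ r ∈ Finset.range (n + 1),
        (-1 : ℝ) ^ (n + k + r) * ((4 : ℝ) ^ (k + 1) - 1) *
          ((k + δ).choose r : ℝ) * ((w - k).choose (n - r) : ℝ) *
          ((bernoulli (2 * k + 2) : ℝ) / ((2 * k + 2).factorial : ℝ)) *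
          ((bernoulli (2 * w - 2 * k) : ℝ) / ((2 * w - 2 * k).factorial : ℝ)) := by
  rw [tancPoly, Finset.Nat.sum_antidiagonal_eq_sum_range_succ_mk, Finset.mul_sum, Finset.mul_sum,
    finsetSum_coeff]
  refine Finset.sum_congr rfl fun k hk => ?_
  obtain ⟨m, rfl⟩ := Nat.exists_eq_add_of_le (Finset.mem_range_succ_iff.1 hk)
  rw [mul_left_comm, ← mul_assoc ((X + 1) ^ δ), ← pow_add, add_comm δ, coeff_C_mul,
    coeff_X_add_one_pow_mul_X_sub_one_pow, Finset.mul_sum, Finset.mul_sum]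
  refine Finset.sum_congr rfl fun r _ => ?_
  have hsign : (-1 : ℝ) ^ (n + k + r) = (-1) ^ k * (-1) ^ m * (-1) ^ (m + n + r) := by
    rw [← pow_add, ← pow_add, show k + m + (m + n + r) = n + k + r + 2 * m by ring,
      pow_add _ (n + k + r), (even_two_mul m).neg_one_pow, mul_one]
  rw [Nat.add_sub_cancel_left, mul_add 2 k m, Nat.add_sub_cancel_left, tanCoeff, cotCoeff, hsign,
    pow_add Real.pi]
  ring

end Coeff

theorem theorem2 (d n : ℕ) (hd : 1 ≤ d) :
    -- all the series that occur in the three sums converge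
    (∀ (a : Fin (2 * d) → ℕ) (b : ℕ),
      Summable (zetaStarTerm (word321 d a ++ List.replicate b 2))) ∧
    ZStar₀ d n = 4 * Real.pi ^ (2 * n + 4 * d) *
      ∑ k ∈ Finset.range (n + 2 * d + 1), ∑ r ∈ Finset.range (n + 1),
        (-1 : ℝ) ^ (n + k + r) * ((4 : ℝ) ^ (k + 1) - 1) *
          (k.choose r : ℝ) * ((n + 2 * d - k).choose (n - r) : ℝ) *
          ((bernoulli (2 * k + 2) : ℝ) / ((2 * k + 2).factorial : ℝ)) *
          ((bernoulli (2 * n + 4 * d - 2 * k) : ℝ) /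
            ((2 * n + 4 * d - 2 * k).factorial : ℝ)) ∧
    ZStar d n = 4 * Real.pi ^ (2 * n + 4 * d) *
      ∑ k ∈ Finset.range (n + 2 * d + 1), ∑ r ∈ Finset.range (n + 1),
        (-1 : ℝ) ^ (n + k + r) * ((4 : ℝ) ^ (k + 1) - 1) *
          ((k + 1).choose r : ℝ) * ((n + 2 * d - k).choose (n - r) : ℝ) *
          ((bernoulli (2 * k + 2) : ℝ) / ((2 * k + 2).factorial : ℝ)) *
          ((bernoulli (2 * n + 4 * d - 2 * k) : ℝ) /
            ((2 * n + 4 * d - 2 * k).factorial : ℝ)) ∧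
    (1 ≤ n → ZStar₁ d n = 4 * Real.pi ^ (2 * n + 4 * d) *
      ∑ k ∈ Finset.range (n + 2 * d + 1), ∑ r ∈ Finset.range n,
        (-1 : ℝ) ^ (n + k + r + 1) * ((4 : ℝ) ^ (k + 1) - 1) *
          (k.choose r : ℝ) * ((n + 2 * d - k).choose (n - 1 - r) : ℝ) *
          ((bernoulli (2 * k + 2) : ℝ) / ((2 * k + 2).factorial : ℝ)) *
          ((bernoulli (2 * n + 4 * d - 2 * k) : ℝ) /
            ((2 * n + 4 * d - 2 * k).factorial : ℝ))) := by
  have hw : 2 * n + 4 * d = 2 * (n + 2 * d) := by ring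
  have hcoeff (j : ℕ) := coeff_X_add_one_pow_mul_tancPoly 0 (n + 2 * d) j
  simp only [pow_zero, one_mul] at hcoeff
  refine ⟨summable_zetaStarTerm_word321_append d, ?_, ?_, fun hn => ?_⟩
  · rw [ZStar₀_eq_coeff, hw, hcoeff]
    simp only [add_zero]
  · rw [ZStar_eq_coeff, hw, ← pow_one (Polynomial.X + 1), coeff_X_add_one_pow_mul_tancPoly]
  · obtain ⟨j, rfl⟩ := Nat.exists_eq_add_of_le' hn
    rw [ZStar₁_succ_eq_coeff, hw, hcoeff]
    have hsign (k r : ℕ) : (-1 : ℝ) ^ (j + 1 + k + r + 1) = (-1) ^ (j + k + r) := by ring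
    simp only [hsign, add_zero, Nat.add_sub_cancel]
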